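/- \textbf{Theorem (Excess risk bound, low-dimensional features).} Let $\mathcal Z\subseteq\mathbb R^d$ be closed and non-empty, equipped with the Euclidean norm $\|\cdot\|$; let $\mathcal P(\mathcal Z)$ be the Borel probability measures on $\mathcal Z$ and, for $p\ge 1$, $\mathcal P_p(\mathcal Z)$ those with finite $p$-th moment. For probability measures $\mu,\nu$ let $\mathsf W_p(\mu,\nu)=\inf_\pi \mathbb E_\pi[\|X-Y\|^p]^{1/p}\in[0,\infty]$, with $\pi$ ranging over the couplings of $\mu$ and $\nu$, let $\|\mu-\nu\|_{\mathrm{TV}}=\frac12|\mu-\nu|(\mathcal Z)$, and set $$\mathsf W_p^\varepsilon(\mu,\nu)=\inf_{\mu'\in\mathcal P(\mathcal Z):\,\|\mu'-\mu\|_{\mathrm{TV}}\le\varepsilon}\mathsf W_p(\mu',\nu).$$ The resilience of a probability measure $\mu$ is $\tau_p(\mu,\varepsilon)=\sup\{\mathsf W_p(\mu',\mu):\mu'\text{ a probability measure},\ \mu'\le\frac1{1-\varepsilon}\mu\}$, and that of a family $\mathcal G$ is $\tau_p(\mathcal G,\varepsilon)=\sup_{\mu\in\mathcal G}\tau_p(\mu,\varepsilon)$.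 \emph{Setting.} Fix $p\ge1$, $\rho\ge0$ and $\varepsilon\in[0,0.49]$. Let $\mathcal L\subseteq\mathbb R^{\mathcal Z}$ be a family of lower semicontinuous functions $\ell$ with $\sup_{z\in\mathcal Z}\frac{\ell(z)}{1+\|z\|^p}<\infty$, and let $\mathcal G\subseteq\mathcal P_p(\mathcal Z)$. Let $\mu\in\mathcal G$ and let $\tilde\mu\in\mathcal P(\mathcal Z)$ satisfy $\mathsf W_p^\varepsilon(\tilde\mu,\mu)\le\rho$. Let $\hat\ell\in\mathcal L$ be a minimizer of the outlier-robust WDRO problem $$\inf_{\ell\in\mathcal L}\ \sup_{\nu\in\mathcal G:\ \mathsf W_p^\varepsilon(\tilde\mu,\nu)\le\rho}\mathbb E_\nu[\ell],$$ where expectations take values in $[-\infty,\infty)$. \emph{Low-dimensional structure.} Let $k\le d$ and let $\ell_\star=\underline\ell\circ A:\mathbb R^d\to\mathbb R$ for an affine map $A:\mathbb R^d\to\mathbb R^k$ and a function $\underline\ell:\mathbb R^k\to\mathbb R$, such that the restriction of $\ell_\star$ to $\mathcal Z$ belongs to $\mathcal L$ and minimizes $\mathbb E_\mu[\ell]$ over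 $\ell\in\mathcal L$. Let $\mathcal G^{(k)}=\{U_\#\nu:\nu\in\mathcal G,\ U\in\mathbb R^{k\times d},\ UU^\top=I_k\}$ and $$r_p=c\rho+2\tau_p(\mathcal G^{(k)},2\varepsilon),\qquad c=2(1-2\varepsilon)^{-1/p}.$$ \emph{Conclusion.} \begin{itemize} \item If $p=1$ and $\ell_\star$ is Lipschitz on $\mathbb R^d$ with least Lipschitz constant $\|\ell_\star\|_{\mathrm{Lip}}$, then $$\mathbb E_\mu[\hat\ell]-\mathbb E_\mu[\ell_\star]\le\|\ell_\star\|_{\mathrm{Lip}}\,r_1 .$$ \item If $p=2$ and $\ell_\star$ is $\alpha$-smooth on $\mathbb R^d$ for some $\alpha\ge0$ (continuously differentiable with $\alpha$-Lipschitz gradient), then $$\mathbb E_\mu[\hat\ell]-\mathbb E_\mu[\ell_\star]\le\mathbb E_\mu[\|\nabla\ell_\star\|^2]^{1/2}\,r_2+\tfrac12\alpha\,r_2^2 .$$ \end{itemize} Here the right-hand sides may be $+\infty$, with the convention $0\cdot\infty=0$. -/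

import Mathlib

open MeasureTheory
open scoped ENNReal NNReal Matrix

noncomputable section

/-- The Euclidean space `ℝ^d`. -/
abbrev EucSp (d : ℕ) : Type := EuclideanSpace ℝ (Fin d)

/-- Expectation `E_μ[f]` as an extended real number: integral of the positive part minus integral
of the negative part. It is the usual expectation (with values in `[-∞, ∞)`) as soon as the
positive part of `f` is integrable. -/
def expect {α : Type*} [MeasurableSpace α] (μ : Measure α) (f : α → ℝ) : EReal :=
  ((∫⁻ x, ENNReal.ofReal (f x) ∂μ : ℝ≥0∞) : EReal) -
    ((∫⁻ x, ENNReal.ofReal (-f x) ∂μ : ℝ≥0∞) : EReal)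

/-- The set `Π(μ, ν)` of couplings of `μ` and `ν`. -/
def couplings {α : Type*} [MeasurableSpace α] (μ ν : Measure α) : Set (Measure (α × α)) :=
  {π | π.map Prod.fst = μ ∧ π.map Prod.snd = ν}

/-- The `p`-Wasserstein distance `W_p(μ, ν) = inf_π (E_π ‖X - Y‖^p)^(1/p)`, with values
in `[0, ∞]`. -/
def wassersteinDist {α : Type*} [MeasurableSpace α] [PseudoEMetricSpace α] (p : ℝ)
    (μ ν : Measure α) : ℝ≥0∞ :=
  ⨅ π ∈ couplings μ ν, (∫⁻ x, edist x.1 x.2 ^ p ∂π) ^ (1 / p)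

/-- The total variation distance `‖μ - ν‖_TV = |μ - ν|(α) / 2`. -/
def tvDistance {α : Type*} [MeasurableSpace α] (μ ν : ProbabilityMeasure α) : ℝ≥0∞ :=
  ((μ : Measure α).toSignedMeasure - (ν : Measure α).toSignedMeasure).totalVariation Set.univ / 2

/-- The `ε`-outlier-robust `p`-Wasserstein distance
`W_p^ε(μ, ν) = inf {W_p(μ', ν) : ‖μ' - μ‖_TV ≤ ε}`. -/
def robustWasserstein {α : Type*} [MeasurableSpace α] [PseudoEMetricSpace α] (p ε : ℝ)
    (μ ν : ProbabilityMeasure α) : ℝ≥0∞ :=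
  ⨅ (μ' : ProbabilityMeasure α) (_ : tvDistance μ' μ ≤ ENNReal.ofReal ε),
    wassersteinDist p (μ' : Measure α) (ν : Measure α)

/-- The `p`-Wasserstein resilience `τ_p(μ, ε)`: the supremum of `W_p(μ', μ)` over probability
measures `μ' ≤ (1 - ε)⁻¹ μ`. -/
def resilience {α : Type*} [MeasurableSpace α] [PseudoEMetricSpace α] (p ε : ℝ)
    (μ : ProbabilityMeasure α) : ℝ≥0∞ :=
  ⨆ (μ' : ProbabilityMeasure α)
    (_ : (μ' : Measure α) ≤ (ENNReal.ofReal (1 - ε))⁻¹ • (μ : Measure α)),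
    wassersteinDist p (μ' : Measure α) (μ : Measure α)

/-- The resilience of a family, `τ_p(G, ε) = sup_{μ ∈ G} τ_p(μ, ε)`. -/
def familyResilience {α : Type*} [MeasurableSpace α] [PseudoEMetricSpace α] (p ε : ℝ)
    (G : Set (ProbabilityMeasure α)) : ℝ≥0∞ :=
  ⨆ μ ∈ G, resilience p ε μ

/-- The class `P_p` of probability measures with finite `p`-th moment. -/
def finiteMoment (α : Type*) [MeasurableSpace α] [PseudoEMetricSpace α] (p : ℝ) :
    Set (ProbabilityMeasure α) :=
  {μ | ⨅ z₀ : α, ∫⁻ z, edist z z₀ ^ p ∂(μ : Measure α) < ∞}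

/-- The objective of the outlier-robust WDRO problem: the worst-case risk
`sup {E_ν[ℓ] : ν ∈ G, W_p^ε(μt, ν) ≤ ρ}`, where `μt` is the observed corrupted measure. -/
def worstCaseRisk {α : Type*} [MeasurableSpace α] [PseudoEMetricSpace α] (p ε ρ : ℝ)
    (G : Set (ProbabilityMeasure α)) (μt : ProbabilityMeasure α) (l : α → ℝ) : EReal :=
  ⨆ (ν : ProbabilityMeasure α)
    (_ : ν ∈ G ∧ robustWasserstein p ε μt ν ≤ ENNReal.ofReal ρ), expect (ν : Measure α) l

/-- The family `G^(k)` of all `k`-dimensional orthogonal projections `U_# μ`, where `μ ∈ G` and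
`U` is a `k × d` matrix with `U Uᵀ = I_k`. -/
def projectedFamily {d : ℕ} {Z : Set (EucSp d)} (k : ℕ) (G : Set (ProbabilityMeasure Z)) :
    Set (ProbabilityMeasure (EucSp k)) :=
  {κ | ∃ U : Matrix (Fin k) (Fin d) ℝ, U * Uᵀ = 1 ∧ ∃ μ ∈ G,
    (κ : Measure (EucSp k)) =
      (μ : Measure Z).map (fun z : Z => Matrix.toEuclideanLin U (z : EucSp d))}

/-- The Lipschitz seminorm: the least Lipschitz constant (`∞` if there is none). -/
def lipSeminorm {α : Type*} [PseudoEMetricSpace α] (f : α → ℝ) : ℝ≥0∞ :=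
  ⨅ (K : ℝ≥0) (_ : LipschitzWith K f), (K : ℝ≥0∞)

/-- `f` is `a`-smooth: continuously differentiable with `a`-Lipschitz gradient. -/
def IsSmoothWith {d : ℕ} (a : ℝ≥0) (f : EucSp d → ℝ) : Prop :=
  ContDiff ℝ 1 f ∧ LipschitzWith a (gradient f)

/-- The homogeneous Sobolev seminorm `E_μ[‖∇f‖^p]^(1/p)`. -/
def sobolevSeminorm {d : ℕ} (p : ℝ) (μ : Measure (EucSp d)) (f : EucSp d → ℝ) : ℝ≥0∞ :=
  (∫⁻ z, ‖gradient f z‖ₑ ^ p ∂μ) ^ (1 / p)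

/-- The radius `c ρ + 2 τ_p(G^(k), 2ε)` with `c = 2 (1 - 2ε)^(-1/p)`. -/
def riskRadius {d : ℕ} {Z : Set (EucSp d)} (p ε ρ : ℝ) (k : ℕ)
    (G : Set (ProbabilityMeasure Z)) : ℝ≥0∞ :=
  ENNReal.ofReal (2 * (1 - 2 * ε) ^ (-(1 / p)) * ρ) +
    2 * familyResilience p (2 * ε) (projectedFamily k G)

end

/-! Since `μ` is feasible for the robust problem, the risk of `lhat` under `μ` is at most its
worst-case risk, hence at most that of `lstar`. The excess risk is therefore bounded by the supremum
of E_ν[lstar] - E_μ[lstar] over feasible `ν` (`expect_sub_expect_le`).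

This difference lives in dimension `k`: there is `U` with orthonormal rows such that lstar(UᵀUz) =
lstar(z) (`exists_mul_transpose_eq_one_and_apply_eq`). It is thus a difference of integrals of lstar
∘ Uᵀ against U_#ν and U_#μ. A Lipschitz bound, or the descent lemma with Cauchy–Schwarz, controls it
by W_p(U_#ν, U_#μ).

That distance is at most the radius (`wassersteinDist_map_le_of_robustWasserstein_le`). Up to
transport, `μ` and `ν` are both within total variation ε of the observed measure, so the two
intermediate measures dominate, up to the factor (1-2ε)⁻¹, a common probability measure κ.
Transporting κ back gives 2ε-deletions of `μ` and `ν`, each at cost (1-2ε)^(-1/p) ρ up to slack.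
Resilience pays for the deletions. Since the triangle inequality is applied after projecting, only
the resilience of the projected family enters. -/

/-! ### Couplings: gluing and restriction. -/

section Couplings

open scoped ProbabilityTheory

variable {α β : Type*} [MeasurableSpace α] [MeasurableSpace β]

theorem swap_mem_couplings {μ ν : Measure α} {π : Measure (α × α)} (h : π ∈ couplings μ ν) :
    π.map Prod.swap ∈ couplings ν μ := by
  refine ⟨?_, ?_⟩
  · rw [Measure.map_map measurable_fst measurable_swap]
    exact h.2
  · rw [Measure.map_map measurable_snd measurable_swap]
    exact h.1

theorem isProbabilityMeasure_of_mem_couplings {μ ν : Measure α} [IsProbabilityMeasure μ]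
    {π : Measure (α × α)} (h : π ∈ couplings μ ν) : IsProbabilityMeasure π := by
  have := h.1
  refine ⟨?_⟩
  have h1 := congrArg (fun m => m Set.univ) h.1
  simpa [Measure.map_apply measurable_fst MeasurableSet.univ] using h1

theorem prod_mem_couplings (μ ν : Measure α) [IsProbabilityMeasure μ] [IsProbabilityMeasure ν] :
    μ.prod ν ∈ couplings μ ν := by
  constructor
  · simp [Measure.map_fst_prod]
  · simp [Measure.map_snd_prod]

/-- Gluing of couplings. -/
theorem exists_gluing [StandardBorelSpace α] [Nonempty α] {μ ν κ : Measure α}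
    [IsProbabilityMeasure μ] [IsProbabilityMeasure ν]
    {π₁ π₂ : Measure (α × α)} (h₁ : π₁ ∈ couplings μ ν)
    (h₂ : π₂ ∈ couplings ν κ) :
    ∃ γ : Measure (α × α × α), γ.map (fun x => (x.2.1, x.1)) = π₁ ∧
      γ.map (fun x => (x.1, x.2.2)) = π₂ := by
  have := isProbabilityMeasure_of_mem_couplings h₁
  have := isProbabilityMeasure_of_mem_couplings h₂
  have := isProbabilityMeasure_of_mem_couplings (swap_mem_couplings h₁)
  set π := π₁.map Prod.swap with hπ
  have e₁ : ν ⊗ₘ π.condKernel = π := by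
    have := π.disintegrate π.condKernel
    rwa [Measure.fst, (swap_mem_couplings h₁).1] at this
  have e₂ : ν ⊗ₘ π₂.condKernel = π₂ := by
    have := π₂.disintegrate π₂.condKernel
    rwa [Measure.fst, h₂.1] at this
  -- The first coordinate is the shared middle point; given it, the two outer points are drawn
  -- independently. `π₁` was swapped so that it too disintegrates over `ν`.
  refine ⟨ν ⊗ₘ (π.condKernel.prod π₂.condKernel), ?_, ?_⟩
  · have : (ν ⊗ₘ (π.condKernel.prod π₂.condKernel)).map (Prod.map id Prod.fst) = π := by
      rw [← Measure.compProd_map measurable_fst, ← ProbabilityTheory.Kernel.fst_eq,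
        ProbabilityTheory.Kernel.fst_prod, e₁]
    have hsw : π.map Prod.swap = π₁ := by
      rw [hπ, Measure.map_map measurable_swap measurable_swap]
      simp
    refine Eq.trans ?_ ((congrArg (Measure.map Prod.swap) this).trans hsw)
    rw [Measure.map_map measurable_swap (by fun_prop)]
    rfl
  · have : (ν ⊗ₘ (π.condKernel.prod π₂.condKernel)).map (Prod.map id Prod.snd) = π₂ := by
      rw [← Measure.compProd_map measurable_snd, ← ProbabilityTheory.Kernel.snd_eq,
        ProbabilityTheory.Kernel.snd_prod, e₂]
    exact this

/-- If `κ ≤ c μ`, then a coupling of `μ` and `ν` restricts to a coupling of `κ` with a measure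
dominated by `c ν`. -/
theorem exists_le_smul_coupling {μ ν κ : Measure α} [IsProbabilityMeasure μ]
    [IsProbabilityMeasure κ] {c : ℝ≥0∞} (hc : c ≠ ∞) (hκ : κ ≤ c • μ)
    {π : Measure (α × α)} (h : π ∈ couplings μ ν) :
    ∃ (ν' : ProbabilityMeasure α) (π' : Measure (α × α)), π' ∈ couplings κ ν' ∧ π' ≤ c • π ∧
      (ν' : Measure α) ≤ c • ν := by
  have hfin : IsFiniteMeasure (c • μ) := Measure.smul_finite _ hc
  set f := κ.rnDeriv (c • μ) with hf
  have hfm : Measurable f := Measure.measurable_rnDeriv _ _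
  have hfk : (c • μ).withDensity f = κ :=
    Measure.withDensity_rnDeriv_eq _ _ (Measure.absolutelyContinuous_of_le hκ)
  have hf1 : f ≤ᵐ[c • μ] 1 := Measure.rnDeriv_le_one_of_le hκ
  have hmap : (c • π).map Prod.fst = c • μ := by rw [Measure.map_smul, h.1]
  -- Reweighting by a function of the first point alone turns the first marginal into `κ`; the
  -- density is at most 1, so nothing exceeds `c • π`.
  set π' := (c • π).withDensity (f ∘ Prod.fst) with hπ'
  have hle : π' ≤ c • π := by
    have : f ∘ Prod.fst ≤ᵐ[c • π] 1 := by
      rw [← hmap] at hf1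
      exact ae_of_ae_map measurable_fst.aemeasurable hf1
    calc π' ≤ (c • π).withDensity 1 := withDensity_mono this
      _ = c • π := withDensity_one
  have hfst : π'.map Prod.fst = κ := by
    rw [← hfk, ← hmap]
    ext s hs
    rw [Measure.map_apply measurable_fst hs, withDensity_apply _ (measurable_fst hs),
      withDensity_apply _ hs, setLIntegral_map hs hfm measurable_fst]
    rfl
  have hprob : IsProbabilityMeasure (π'.map Prod.snd) := by
    refine ⟨?_⟩
    have h1 := congrArg (fun m => m Set.univ) hfst
    simp only [Measure.map_apply measurable_fst MeasurableSet.univ, Set.preimage_univ,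
      measure_univ] at h1
    rw [Measure.map_apply measurable_snd MeasurableSet.univ, Set.preimage_univ, h1]
  refine ⟨⟨π'.map Prod.snd, hprob⟩, π', ⟨hfst, rfl⟩, hle, ?_⟩
  calc π'.map Prod.snd ≤ (c • π).map Prod.snd := Measure.map_mono hle measurable_snd
    _ = c • ν := by rw [Measure.map_smul, h.2]

end Couplings

/-! ### Total variation and common parts of measures. -/

section TotalVariation

variable {α : Type*} [MeasurableSpace α]

/-- For probability measures a set and its complement have the same discrepancy in absolute value,
and both count in the total variation; this compensates the factor 1/2 in `tvDistance`. -/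
theorem measureReal_sub_le_of_tvDistance_le {μ ν : ProbabilityMeasure α} {ε : ℝ} (hε : 0 ≤ ε)
    (h : tvDistance μ ν ≤ ENNReal.ofReal ε) {s : Set α} (hs : MeasurableSet s) :
    |(μ : Measure α).real s - (ν : Measure α).real s| ≤ ε := by
  unfold tvDistance at h
  set σ := (μ : Measure α).toSignedMeasure - (ν : Measure α).toSignedMeasure with hσ
  have e (t : Set α) (ht : MeasurableSet t) :
      σ t = (μ : Measure α).real t - (ν : Measure α).real t := by
    rw [hσ, _root_.sub_apply, Measure.toSignedMeasure_apply_measurable ht,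
      Measure.toSignedMeasure_apply_measurable ht]
  have h1 := σ.norm_le_totalVariation s
  have h2 := σ.norm_le_totalVariation sᶜ
  rw [e _ hs, Real.norm_eq_abs] at h1
  rw [e _ hs.compl, probReal_compl_eq_one_sub hs, probReal_compl_eq_one_sub hs,
    Real.norm_eq_abs] at h2
  have h3 : σ.totalVariation.real s + σ.totalVariation.real sᶜ
      = σ.totalVariation.real Set.univ := measureReal_add_measureReal_compl hs
  have h4 : σ.totalVariation.real Set.univ ≤ 2 * ε := by
    refine ENNReal.toReal_le_of_le_ofReal (by positivity) ?_
    rw [ENNReal.ofReal_mul (by norm_num), ENNReal.ofReal_ofNat, mul_comm]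
    exact (ENNReal.div_le_iff (by simp) (by simp)).1 h
  have h5 : |1 - (μ : Measure α).real s - (1 - (ν : Measure α).real s)| =
      |(μ : Measure α).real s - (ν : Measure α).real s| := by
    rw [abs_sub_comm]; congr 1; ring
  rw [h5] at h2
  linarith

/-- Two probability measures whose values differ by at most `δ < 1` dominate, up to the factor
`(1 - δ)⁻¹`, a common probability measure. -/
theorem exists_le_smul_le_smul {μ ν : Measure α} [IsProbabilityMeasure μ]
    [IsProbabilityMeasure ν] {δ : ℝ} (hδ : δ < 1)
    (h : ∀ s, MeasurableSet s → ν.real s - μ.real s ≤ δ) :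
    ∃ κ : ProbabilityMeasure α, (κ : Measure α) ≤ (ENNReal.ofReal (1 - δ))⁻¹ • μ ∧
      (κ : Measure α) ≤ (ENNReal.ofReal (1 - δ))⁻¹ • ν := by
  obtain ⟨s, hs⟩ := exists_isHahnDecomposition μ ν
  have hsm := hs.measurableSet
  -- This is the minimum of `μ` and `ν`. Its mass is 1 - (ν(s) - μ(s)) ≥ 1 - δ, so normalizing costs
  -- a factor of at most (1 - δ)⁻¹.
  set m : Measure α := μ.restrict s + ν.restrict sᶜ with hm
  have hmμ : m ≤ μ := by
    calc m ≤ μ.restrict s + μ.restrict sᶜ := add_le_add le_rfl hs.ge_on_compl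
      _ = μ := Measure.restrict_add_restrict_compl hsm
  have hmν : m ≤ ν := by
    calc m ≤ ν.restrict s + ν.restrict sᶜ := add_le_add hs.le_on le_rfl
      _ = ν := Measure.restrict_add_restrict_compl hsm
  have hmass : ENNReal.ofReal (1 - δ) ≤ m Set.univ := by
    have : m Set.univ = ENNReal.ofReal (μ.real s + ν.real sᶜ) := by
      rw [ENNReal.ofReal_add measureReal_nonneg measureReal_nonneg]
      simp [hm]
    rw [this, probReal_compl_eq_one_sub hsm]
    exact ENNReal.ofReal_le_ofReal (by linarith [h s hsm])
  have h0 : m Set.univ ≠ 0 := fun h0 => by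
    rw [h0, nonpos_iff_eq_zero, ENNReal.ofReal_eq_zero] at hmass
    linarith
  have h1 : m Set.univ ≠ ∞ := ((hmμ Set.univ).trans_lt (by simp)).ne
  have hp : IsProbabilityMeasure ((m Set.univ)⁻¹ • m) :=
    ⟨by simpa using ENNReal.inv_mul_cancel h0 h1⟩
  have key (ξ : Measure α) (hξ : m ≤ ξ) :
      (m Set.univ)⁻¹ • m ≤ (ENNReal.ofReal (1 - δ))⁻¹ • ξ := by
    refine Measure.le_iff.2 fun t _ => ?_
    simp only [Measure.smul_apply, smul_eq_mul]
    exact mul_le_mul' (ENNReal.inv_le_inv.2 hmass) (hξ t)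
  exact ⟨⟨_, hp⟩, key μ hmμ, key ν hmν⟩

end TotalVariation

/-! ### Wasserstein distance, resilience and the robust triangle inequality. -/

section Wasserstein

variable {α β : Type*} [MeasurableSpace α] [MeasurableSpace β] [PseudoEMetricSpace α]
  [PseudoEMetricSpace β]

theorem wassersteinDist_le_of_mem_couplings {p : ℝ} {μ ν : Measure α} {π : Measure (α × α)}
    (h : π ∈ couplings μ ν) :
    wassersteinDist p μ ν ≤ (∫⁻ x, edist x.1 x.2 ^ p ∂π) ^ (1 / p) :=
  iInf₂_le π h

theorem exists_coupling_lt_of_wassersteinDist_lt {p : ℝ} {μ ν : Measure α} {r : ℝ≥0∞}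
    (h : wassersteinDist p μ ν < r) :
    ∃ π ∈ couplings μ ν, (∫⁻ x, edist x.1 x.2 ^ p ∂π) ^ (1 / p) < r := by
  simpa [wassersteinDist, iInf_lt_iff] using h

/-- Mass deletion is carried along a transport plan: the restricted plan is dominated by `c` times
the original, so the cost integral grows by at most `c` and its `p`-th root by `c ^ (1 / p)`. This
is the source of the factor (1-2ε)^(-1/p). -/
theorem exists_le_smul_wassersteinDist_le {p : ℝ} (hp : 0 ≤ p) {μ ν κ : Measure α}
    [IsProbabilityMeasure μ] [IsProbabilityMeasure κ] {c : ℝ≥0∞} (hc : c ≠ ∞) (hκ : κ ≤ c • μ)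
    {r : ℝ≥0∞} (h : wassersteinDist p μ ν < r) :
    ∃ ν' : ProbabilityMeasure α, (ν' : Measure α) ≤ c • ν ∧
      wassersteinDist p κ ν' ≤ c ^ (1 / p) * r := by
  obtain ⟨π, hπ, hr⟩ := exists_coupling_lt_of_wassersteinDist_lt h
  obtain ⟨ν', π', hπ', hle, hν'⟩ := exists_le_smul_coupling hc hκ hπ
  refine ⟨ν', hν', (wassersteinDist_le_of_mem_couplings hπ').trans ?_⟩
  calc (∫⁻ x, edist x.1 x.2 ^ p ∂π') ^ (1 / p)
      ≤ (c * ∫⁻ x, edist x.1 x.2 ^ p ∂π) ^ (1 / p) := by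
        refine ENNReal.rpow_le_rpow ?_ (by positivity)
        refine (lintegral_mono' hle le_rfl).trans_eq ?_
        rw [lintegral_smul_measure, smul_eq_mul]
    _ = c ^ (1 / p) * (∫⁻ x, edist x.1 x.2 ^ p ∂π) ^ (1 / p) :=
        ENNReal.mul_rpow_of_nonneg _ _ (by positivity)
    _ ≤ _ := by gcongr

theorem exists_tvDistance_le_of_robustWasserstein_lt {p ε : ℝ} {μ ν : ProbabilityMeasure α}
    {r : ℝ≥0∞} (h : robustWasserstein p ε μ ν < r) :
    ∃ μ' : ProbabilityMeasure α, tvDistance μ' μ ≤ ENNReal.ofReal ε ∧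
      wassersteinDist p (μ' : Measure α) (ν : Measure α) < r := by
  simpa [robustWasserstein, iInf_lt_iff] using h

/-- Two measures that are robustly `r`-close to the same measure have `2ε`-deletions that are
close to a common probability measure. -/
theorem exists_common_of_robustWasserstein_lt {p ε : ℝ} (hp : 0 ≤ p) (hε : 0 ≤ ε)
    (hε' : 2 * ε < 1) {μ ν ξ : ProbabilityMeasure α} {r : ℝ≥0∞}
    (hμ : robustWasserstein p ε ξ μ < r) (hν : robustWasserstein p ε ξ ν < r) :
    ∃ κ μ' ν' : ProbabilityMeasure α,
      (μ' : Measure α) ≤ (ENNReal.ofReal (1 - 2 * ε))⁻¹ • (μ : Measure α) ∧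
      (ν' : Measure α) ≤ (ENNReal.ofReal (1 - 2 * ε))⁻¹ • (ν : Measure α) ∧
      wassersteinDist p (κ : Measure α) μ' ≤ (ENNReal.ofReal (1 - 2 * ε))⁻¹ ^ (1 / p) * r ∧
      wassersteinDist p (κ : Measure α) ν' ≤ (ENNReal.ofReal (1 - 2 * ε))⁻¹ ^ (1 / p) * r := by
  obtain ⟨μ₁, hμ₁, hμr⟩ := exists_tvDistance_le_of_robustWasserstein_lt hμ
  obtain ⟨ν₁, hν₁, hνr⟩ := exists_tvDistance_le_of_robustWasserstein_lt hν
  -- The level 2ε comes from comparing `μ₁` and `ν₁` through `ξ`, each within ε of it.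
  obtain ⟨κ, hκμ, hκν⟩ := exists_le_smul_le_smul (μ := (μ₁ : Measure α)) (ν := (ν₁ : Measure α))
    hε' fun s hs => by
      have h1 := abs_le.1 (measureReal_sub_le_of_tvDistance_le hε hμ₁ hs)
      have h2 := abs_le.1 (measureReal_sub_le_of_tvDistance_le hε hν₁ hs)
      linarith
  have hc : (ENNReal.ofReal (1 - 2 * ε))⁻¹ ≠ ∞ := by
    simpa using hε'
  obtain ⟨μ', hμ', hμ'r⟩ := exists_le_smul_wassersteinDist_le hp hc hκμ hμr
  obtain ⟨ν', hν', hν'r⟩ := exists_le_smul_wassersteinDist_le hp hc hκν hνr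
  exact ⟨κ, μ', ν', hμ', hν', hμ'r, hν'r⟩

theorem wassersteinDist_le_resilience {p δ : ℝ} {μ μ' : ProbabilityMeasure α}
    (h : (μ' : Measure α) ≤ (ENNReal.ofReal (1 - δ))⁻¹ • (μ : Measure α)) :
    wassersteinDist p (μ' : Measure α) μ ≤ resilience p δ μ :=
  le_iSup₂ (f := fun (ν : ProbabilityMeasure α)
    (_ : (ν : Measure α) ≤ (ENNReal.ofReal (1 - δ))⁻¹ • (μ : Measure α)) =>
      wassersteinDist p (ν : Measure α) (μ : Measure α)) μ' h

theorem wassersteinDist_map_le [OpensMeasurableSpace β]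
    [SecondCountableTopology β] {p : ℝ} (hp : 0 ≤ p) {f : α → β} (hf : Measurable f)
    (hf1 : ∀ x y, edist (f x) (f y) ≤ edist x y) (μ ν : Measure α) :
    wassersteinDist p (μ.map f) (ν.map f) ≤ wassersteinDist p μ ν := by
  refine le_iInf₂ fun π hπ => ?_
  have hmem : π.map (Prod.map f f) ∈ couplings (μ.map f) (ν.map f) := by
    constructor
    · rw [Measure.map_map measurable_fst (by fun_prop), ← hπ.1,
        Measure.map_map hf measurable_fst]
      rfl
    · rw [Measure.map_map measurable_snd (by fun_prop), ← hπ.2,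
        Measure.map_map hf measurable_snd]
      rfl
  refine (wassersteinDist_le_of_mem_couplings hmem).trans ?_
  rw [lintegral_map (by fun_prop) (by fun_prop)]
  refine ENNReal.rpow_le_rpow (lintegral_mono fun x => ?_) (by positivity)
  exact ENNReal.rpow_le_rpow (hf1 _ _) hp

theorem wassersteinDist_comm [OpensMeasurableSpace α] [SecondCountableTopology α] (p : ℝ) (μ ν : Measure α) :
    wassersteinDist p μ ν = wassersteinDist p ν μ := by
  have key (μ ν : Measure α) : wassersteinDist p μ ν ≤ wassersteinDist p ν μ := by
    refine le_iInf₂ fun π hπ => (wassersteinDist_le_of_mem_couplings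
      (swap_mem_couplings hπ)).trans_eq ?_
    rw [lintegral_map (by fun_prop) measurable_swap]
    simp [edist_comm]
  exact le_antisymm (key μ ν) (key ν μ)

/-- Glue near-optimal couplings along `ν` and apply Minkowski's inequality in L^p of the glued
measure; the slack `δ` avoids any appeal to optimal couplings. -/
theorem wassersteinDist_triangle [OpensMeasurableSpace α] [SecondCountableTopology α]
    [StandardBorelSpace α] {p : ℝ} (hp : 1 ≤ p)
    (μ ν κ : Measure α) [IsProbabilityMeasure μ] [IsProbabilityMeasure ν] :
    wassersteinDist p μ κ ≤ wassersteinDist p μ ν + wassersteinDist p ν κ := by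
  have : Nonempty α := nonempty_of_isProbabilityMeasure μ
  refine ENNReal.le_of_forall_pos_le_add fun δ hδ hfin => ?_
  have hδ' : ((δ / 2 : ℝ≥0) : ℝ≥0∞) ≠ 0 := by simpa using hδ.ne'
  obtain ⟨h1, h2⟩ := ENNReal.add_lt_top.1 hfin
  obtain ⟨π₁, hπ₁, hc₁⟩ := exists_coupling_lt_of_wassersteinDist_lt
    (ENNReal.lt_add_right h1.ne hδ')
  obtain ⟨π₂, hπ₂, hc₂⟩ := exists_coupling_lt_of_wassersteinDist_lt
    (ENNReal.lt_add_right h2.ne hδ')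
  obtain ⟨γ, hγ₁, hγ₂⟩ := exists_gluing hπ₁ hπ₂
  have hmem : γ.map (fun x => (x.2.1, x.2.2)) ∈ couplings μ κ := by
    constructor
    · rw [← hπ₁.1, ← hγ₁, Measure.map_map (by fun_prop) (by fun_prop),
        Measure.map_map (by fun_prop) (by fun_prop)]
      rfl
    · rw [← hπ₂.2, ← hγ₂, Measure.map_map (by fun_prop) (by fun_prop),
        Measure.map_map (by fun_prop) (by fun_prop)]
      rfl
  rw [← hγ₁, lintegral_map (by fun_prop) (by fun_prop)] at hc₁
  rw [← hγ₂, lintegral_map (by fun_prop) (by fun_prop)] at hc₂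
  have hp0 : 0 ≤ p := by linarith
  calc wassersteinDist p μ κ
      ≤ (∫⁻ x, edist x.2.1 x.2.2 ^ p ∂γ) ^ (1 / p) := by
        refine (wassersteinDist_le_of_mem_couplings hmem).trans_eq ?_
        rw [lintegral_map (by fun_prop) (by fun_prop)]
    _ ≤ (∫⁻ x, ((fun x : α × α × α => edist x.2.1 x.1) + fun x : α × α × α => edist x.1 x.2.2) x ^ p ∂γ)
          ^ (1 / p) := by
        refine ENNReal.rpow_le_rpow (lintegral_mono fun x => ?_) (by positivity)
        exact ENNReal.rpow_le_rpow (edist_triangle _ _ _) hp0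
    _ ≤ (∫⁻ x, edist x.2.1 x.1 ^ p ∂γ) ^ (1 / p) + (∫⁻ x, edist x.1 x.2.2 ^ p ∂γ) ^ (1 / p) :=
        ENNReal.lintegral_Lp_add_le (by fun_prop) (by fun_prop) hp
    _ ≤ (wassersteinDist p μ ν + (δ / 2 : ℝ≥0)) + (wassersteinDist p ν κ + (δ / 2 : ℝ≥0)) :=
        add_le_add hc₁.le hc₂.le
    _ = wassersteinDist p μ ν + wassersteinDist p ν κ + δ := by
        rw [add_add_add_comm, ← ENNReal.coe_add, add_halves]

/-- Non-expansive images of two measures that are robustly close to the same measure are close, up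
to the resilience of the images. -/
theorem wassersteinDist_map_le_of_robustWasserstein_le [OpensMeasurableSpace β]
    [SecondCountableTopology β] [StandardBorelSpace β] {p ε ρ : ℝ}
    (hp : 1 ≤ p) (hε : 0 ≤ ε) (hε' : 2 * ε < 1) {μ ν ξ : ProbabilityMeasure α}
    (hμ : robustWasserstein p ε ξ μ ≤ ENNReal.ofReal ρ)
    (hν : robustWasserstein p ε ξ ν ≤ ENNReal.ofReal ρ)
    {f : α → β} (hf : Measurable f) (hf1 : ∀ x y, edist (f x) (f y) ≤ edist x y)
    {t : ℝ≥0∞} (hμt : resilience p (2 * ε) (μ.map hf.aemeasurable) ≤ t)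
    (hνt : resilience p (2 * ε) (ν.map hf.aemeasurable) ≤ t) :
    wassersteinDist p ((ν : Measure α).map f) ((μ : Measure α).map f) ≤
      ENNReal.ofReal (2 * (1 - 2 * ε) ^ (-(1 / p)) * ρ) + 2 * t := by
  have hp0 : 0 ≤ p := by linarith
  have hpos : 0 < 1 - 2 * ε := by linarith
  set c : ℝ≥0∞ := (ENNReal.ofReal (1 - 2 * ε))⁻¹ ^ (1 / p) with hc
  have hc' : c = ENNReal.ofReal ((1 - 2 * ε) ^ (-(1 / p))) := by
    rw [hc, ENNReal.inv_rpow, ← ENNReal.rpow_neg, ENNReal.ofReal_rpow_of_pos hpos]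
  have hc0 : c ≠ 0 := by
    rw [hc', ne_eq, ENNReal.ofReal_eq_zero, not_le]
    positivity
  have hc1 : c ≠ ∞ := by simp [hc']
  -- The infima defining the robust distance need not be attained, so the bound is proved for every
  -- `r` above `ρ` and then passed to the limit.
  have key (r : ℝ≥0∞) (hr : ENNReal.ofReal ρ < r) :
      wassersteinDist p ((ν : Measure α).map f) ((μ : Measure α).map f) ≤
        2 * c * r + 2 * t := by
    obtain ⟨κ, μ', ν', hμ', hν', hκμ, hκν⟩ := exists_common_of_robustWasserstein_lt hp0 hε hε'
      (hμ.trans_lt hr) (hν.trans_lt hr)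
    have res {η η' : ProbabilityMeasure α} (hηt : resilience p (2 * ε) (η.map hf.aemeasurable) ≤ t)
        (hη : (η' : Measure α) ≤ (ENNReal.ofReal (1 - 2 * ε))⁻¹ • (η : Measure α)) :
        wassersteinDist p ((η' : Measure α).map f) ((η : Measure α).map f) ≤ t := by
      refine le_trans ?_ hηt
      refine wassersteinDist_le_resilience (μ := η.map hf.aemeasurable)
        (μ' := η'.map hf.aemeasurable) ?_
      simp only [ProbabilityMeasure.toMeasure_map]
      rw [← Measure.map_smul]
      exact Measure.map_mono hη hf
    have pr (η : ProbabilityMeasure α) : IsProbabilityMeasure ((η : Measure α).map f) :=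
      Measure.isProbabilityMeasure_map hf.aemeasurable
    have := pr μ; have := pr ν; have := pr μ'; have := pr ν'; have := pr κ
    -- The chain is ν → ν' → κ → μ' → μ, after applying `f`: the outer legs cost the resilience of
    -- the images, the two inner ones `c * r` each.
    have t1 := wassersteinDist_triangle hp ((ν : Measure α).map f) ((ν' : Measure α).map f)
      ((μ : Measure α).map f)
    have t2 := wassersteinDist_triangle hp ((ν' : Measure α).map f) ((κ : Measure α).map f)
      ((μ : Measure α).map f)
    have t3 := wassersteinDist_triangle hp ((κ : Measure α).map f) ((μ' : Measure α).map f)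
      ((μ : Measure α).map f)
    calc wassersteinDist p ((ν : Measure α).map f) ((μ : Measure α).map f)
        ≤ t + (c * r + (c * r + t)) := by
          refine t1.trans (add_le_add ?_ (t2.trans (add_le_add ?_ (t3.trans (add_le_add ?_ ?_)))))
          · rw [wassersteinDist_comm]; exact res hνt hν'
          · rw [wassersteinDist_comm]
            exact (wassersteinDist_map_le hp0 hf hf1 _ _).trans hκν
          · exact (wassersteinDist_map_le hp0 hf hf1 _ _).trans hκμ
          · exact res hμt hμ'
      _ = 2 * c * r + 2 * t := by ring
  have hlim : ENNReal.ofReal (2 * (1 - 2 * ε) ^ (-(1 / p)) * ρ) = 2 * c * ENNReal.ofReal ρ := by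
    rw [hc', ENNReal.ofReal_mul (by positivity), ENNReal.ofReal_mul (by norm_num),
      ENNReal.ofReal_ofNat]
  rw [hlim]
  have hcont : Continuous fun r : ℝ≥0∞ => 2 * c * r + 2 * t :=
    (ENNReal.continuous_const_mul (ENNReal.mul_ne_top (by simp) hc1)).add continuous_const
  have hne : (nhdsWithin (ENNReal.ofReal ρ) (Set.Ioi (ENNReal.ofReal ρ))).NeBot :=
    nhdsGT_neBot_of_exists_gt ⟨∞, by simp⟩
  have hlim := (hcont.tendsto (ENNReal.ofReal ρ)).mono_left
    (nhdsWithin_le_nhds (s := Set.Ioi (ENNReal.ofReal ρ)))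
  exact ge_of_tendsto hlim (eventually_nhdsWithin_of_forall key)

end Wasserstein

/-! ### Orthonormal coordinates for a linear map of low rank. -/

section LinearAlgebra

open Module

theorem toEuclideanLin_of_apply {d k : ℕ} (w : Fin k → EucSp d) (z : EucSp d) (i : Fin k) :
    Matrix.toEuclideanLin (Matrix.of fun i j => w i j) z i = inner ℝ (w i) z := by
  rw [Matrix.toLpLin_apply, PiLp.inner_apply]
  refine (?_ : ∑ j, w i j * z j = ∑ j, z j * w i j)
  exact Finset.sum_congr rfl fun j _ => mul_comm (w i j) (z j)

theorem toEuclideanLin_transpose_of {d k : ℕ} (w : Fin k → EucSp d) (y : EucSp k) :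
    Matrix.toEuclideanLin (Matrix.of fun i j => w i j)ᵀ y = ∑ i, y i • w i := by
  ext j
  simp [Matrix.toLpLin_apply, Matrix.mulVec, dotProduct, mul_comm]

/-- A linear map of rank at most `k` factors through `k` orthonormal coordinates. -/
theorem exists_mul_transpose_eq_one_and_apply_eq {d k : ℕ} (hk : k ≤ d)
    (A : EucSp d →ₗ[ℝ] EucSp k) :
    ∃ U : Matrix (Fin k) (Fin d) ℝ, U * Uᵀ = 1 ∧
      ∀ z, A (Matrix.toEuclideanLin Uᵀ (Matrix.toEuclideanLin U z)) = A z := by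
  have hker : d - k ≤ finrank ℝ (LinearMap.ker A) := by
    have h1 := A.finrank_range_add_finrank_ker
    have h2 := Submodule.finrank_le (LinearMap.range A)
    rw [finrank_euclideanSpace_fin] at h1 h2
    omega
  -- The kernel may have dimension greater than `d - k`; choosing a subspace `N` of it of dimension
  -- exactly `d - k` gives its orthogonal complement dimension exactly `k`, whose orthonormal basis
  -- supplies the rows of `U`.
  obtain ⟨f, hf⟩ := exists_linearIndependent_of_le_finrank hker
  have hf' : LinearIndependent ℝ fun i => (f i : EucSp d) :=
    hf.map' (LinearMap.ker A).subtype (Submodule.ker_subtype _)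
  set N := Submodule.span ℝ (Set.range fun i => (f i : EucSp d)) with hN
  have hNker : N ≤ LinearMap.ker A := by
    rw [hN, Submodule.span_le]
    rintro _ ⟨i, rfl⟩
    exact (f i).2
  have hNrank : finrank ℝ Nᗮ = k := by
    have h1 : finrank ℝ N = d - k := by simpa using finrank_span_eq_card hf'
    have h2 := N.finrank_add_finrank_orthogonal
    rw [finrank_euclideanSpace_fin] at h2
    omega
  obtain ⟨b⟩ : Nonempty (OrthonormalBasis (Fin k) ℝ Nᗮ) :=
    ⟨(stdOrthonormalBasis ℝ Nᗮ).reindex (finCongr hNrank)⟩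
  refine ⟨Matrix.of fun i j => (b i : EucSp d) j, ?_, fun z => ?_⟩
  · ext i j
    rw [Matrix.one_apply, ← orthonormal_iff_ite.1 b.orthonormal i j, Submodule.coe_inner,
      PiLp.inner_apply, Matrix.mul_apply]
    exact Finset.sum_congr rfl fun l _ => mul_comm ((b i : EucSp d) l) ((b j : EucSp d) l)
  -- UᵀU is the orthogonal projection onto Nᗮ, so it moves `z` by an element of `N`, which `A`
  -- kills.
  · have hp : Matrix.toEuclideanLin (Matrix.of fun i j => (b i : EucSp d) j)ᵀ
        (Matrix.toEuclideanLin (Matrix.of fun i j => (b i : EucSp d) j) z) =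
        Nᗮ.starProjection z := by
      rw [toEuclideanLin_transpose_of (fun i => (b i : EucSp d)), b.starProjection_eq_sum_rankOne]
      simp [toEuclideanLin_of_apply (fun i => (b i : EucSp d))]
    have hz : z - Nᗮ.starProjection z ∈ N := by
      have := Nᗮ.sub_starProjection_mem_orthogonal z
      rwa [Submodule.orthogonal_orthogonal] at this
    have := hNker hz
    rw [LinearMap.mem_ker, map_sub, sub_eq_zero] at this
    rw [hp, this]

variable {d k : ℕ} {U : Matrix (Fin k) (Fin d) ℝ}

theorem toEuclideanLin_toEuclideanLin_transpose (hU : U * Uᵀ = 1) (y : EucSp k) :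
    Matrix.toEuclideanLin U (Matrix.toEuclideanLin Uᵀ y) = y := by
  simp [Matrix.toLpLin_apply, hU]

theorem inner_toEuclideanLin_transpose (U : Matrix (Fin k) (Fin d) ℝ) (y : EucSp k) (z : EucSp d) :
    inner ℝ (Matrix.toEuclideanLin Uᵀ y) z = inner ℝ y (Matrix.toEuclideanLin U z) := by
  rw [← Matrix.conjTranspose_eq_transpose_of_trivial, Matrix.toEuclideanLin_conjTranspose_eq_adjoint,
    LinearMap.adjoint_inner_left]

theorem norm_toEuclideanLin_transpose (hU : U * Uᵀ = 1) (y : EucSp k) :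
    ‖Matrix.toEuclideanLin Uᵀ y‖ = ‖y‖ := by
  rw [← sq_eq_sq₀ (norm_nonneg _) (norm_nonneg _), ← real_inner_self_eq_norm_sq,
    ← real_inner_self_eq_norm_sq, inner_toEuclideanLin_transpose,
    toEuclideanLin_toEuclideanLin_transpose hU]

theorem norm_toEuclideanLin_le (hU : U * Uᵀ = 1) (z : EucSp d) :
    ‖Matrix.toEuclideanLin U z‖ ≤ ‖z‖ := by
  by_contra! h
  have h1 : ‖Matrix.toEuclideanLin U z‖ ^ 2 ≤ ‖Matrix.toEuclideanLin U z‖ * ‖z‖ := by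
    rw [← real_inner_self_eq_norm_sq, ← inner_toEuclideanLin_transpose]
    refine (real_inner_le_norm _ _).trans_eq ?_
    rw [norm_toEuclideanLin_transpose hU]
  nlinarith [norm_nonneg z]

theorem edist_toEuclideanLin_transpose (hU : U * Uᵀ = 1) (x y : EucSp k) :
    edist (Matrix.toEuclideanLin Uᵀ x) (Matrix.toEuclideanLin Uᵀ y) = edist x y := by
  rw [edist_eq_enorm_sub, edist_eq_enorm_sub, ← map_sub, ← ofReal_norm,
    ← ofReal_norm, norm_toEuclideanLin_transpose hU]

theorem edist_toEuclideanLin_le (hU : U * Uᵀ = 1) (x y : EucSp d) :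
    edist (Matrix.toEuclideanLin U x) (Matrix.toEuclideanLin U y) ≤ edist x y := by
  rw [edist_eq_enorm_sub, edist_eq_enorm_sub, ← map_sub, ← ofReal_norm,
    ← ofReal_norm]
  exact ENNReal.ofReal_le_ofReal (norm_toEuclideanLin_le hU _)

end LinearAlgebra

/-! ### Differences of integrals bounded by transport cost. -/

section CouplingBounds

variable {α : Type*} [MeasurableSpace α]

theorem ofReal_integral_le_lintegral_ofReal {μ : Measure α} {f : α → ℝ} (hf : Integrable f μ) :
    ENNReal.ofReal (∫ x, f x ∂μ) ≤ ∫⁻ x, ENNReal.ofReal (f x) ∂μ := by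
  refine ENNReal.ofReal_le_of_le_toReal ?_
  rw [integral_eq_lintegral_pos_part_sub_lintegral_neg_part hf]
  exact sub_le_self _ ENNReal.toReal_nonneg

theorem ofReal_integral_sub_integral_le {μ ν : Measure α} {π : Measure (α × α)}
    (hπ : π ∈ couplings μ ν) {g : α → ℝ} (hμ : Integrable g μ) (hν : Integrable g ν) :
    ENNReal.ofReal (∫ x, g x ∂μ - ∫ x, g x ∂ν) ≤ ∫⁻ x, ENNReal.ofReal (g x.1 - g x.2) ∂π := by
  obtain ⟨rfl, rfl⟩ := hπ
  rw [integral_map measurable_fst.aemeasurable hμ.1, integral_map measurable_snd.aemeasurable hν.1,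
    ← integral_sub (show Integrable (fun x : α × α => g x.1) π from
      hμ.comp_measurable measurable_fst) (show Integrable (fun x : α × α => g x.2) π from
      hν.comp_measurable measurable_snd)]
  exact ofReal_integral_le_lintegral_ofReal
    ((hμ.comp_measurable measurable_fst).sub (hν.comp_measurable measurable_snd))

variable [PseudoEMetricSpace α]

/-- A continuous monotone function commutes with an infimum over a nonempty set, and the product
coupling shows that the set is nonempty. No finiteness of the distance is needed. -/
theorem le_apply_wassersteinDist {p : ℝ} {μ ν : Measure α} [IsProbabilityMeasure μ]
    [IsProbabilityMeasure ν] {φ : ℝ≥0∞ → ℝ≥0∞} (hφ : Continuous φ) (hmono : Monotone φ)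
    {b : ℝ≥0∞} (h : ∀ π ∈ couplings μ ν, b ≤ φ ((∫⁻ x, edist x.1 x.2 ^ p ∂π) ^ (1 / p))) :
    b ≤ φ (wassersteinDist p μ ν) := by
  have : Nonempty (couplings μ ν) :=
    ⟨⟨_, prod_mem_couplings μ ν⟩⟩
  rw [wassersteinDist, iInf_subtype', hmono.map_ciInf_of_continuousAt hφ.continuousAt]
  exact le_iInf fun π => h π π.2

/-- The easy half of Kantorovich duality: integrate the pointwise bound against any coupling. -/
theorem ofReal_integral_sub_integral_le_mul_wassersteinDist {μ ν : Measure α}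
    [IsProbabilityMeasure μ] [IsProbabilityMeasure ν] {g : α → ℝ} (hμ : Integrable g μ)
    (hν : Integrable g ν) {c : ℝ≥0∞} (hc : c ≠ ∞)
    (h : ∀ x y, ENNReal.ofReal (g x - g y) ≤ c * edist x y) :
    ENNReal.ofReal (∫ x, g x ∂μ - ∫ x, g x ∂ν) ≤ c * wassersteinDist 1 μ ν := by
  refine le_apply_wassersteinDist (φ := fun r => c * r) (ENNReal.continuous_const_mul hc)
    (fun r s hrs => by dsimp only; gcongr) fun π hπ => ?_
  refine (ofReal_integral_sub_integral_le hπ hμ hν).trans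
    ((lintegral_mono fun x : α × α => h x.1 x.2).trans_eq ?_)
  simp [lintegral_const_mul' _ _ hc]

/-- The slope `G` is evaluated at the second point, so Cauchy–Schwarz on the linear term leaves its
L² norm under `ν` alone, whatever the coupling. Finiteness of that norm makes the bound continuous
in the distance. -/
theorem ofReal_integral_sub_integral_le_of_sq [OpensMeasurableSpace α]
    [SecondCountableTopology α] {μ ν : Measure α}
    [IsProbabilityMeasure μ] [IsProbabilityMeasure ν] {g : α → ℝ} (hμ : Integrable g μ)
    (hν : Integrable g ν) {G : α → ℝ≥0∞} (hG : Measurable G)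
    (hGfin : (∫⁻ x, G x ^ (2 : ℝ) ∂ν) ^ (1 / (2 : ℝ)) ≠ ∞) {c : ℝ≥0∞} (hc : c ≠ ∞)
    (h : ∀ x y, ENNReal.ofReal (g x - g y) ≤ G y * edist x y + c * edist x y ^ (2 : ℝ)) :
    ENNReal.ofReal (∫ x, g x ∂μ - ∫ x, g x ∂ν) ≤
      (∫⁻ x, G x ^ (2 : ℝ) ∂ν) ^ (1 / (2 : ℝ)) * wassersteinDist 2 μ ν +
        c * wassersteinDist 2 μ ν ^ 2 := by
  refine le_apply_wassersteinDist (φ := fun r => (∫⁻ x, G x ^ (2 : ℝ) ∂ν) ^ (1 / (2 : ℝ)) * r +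
    c * r ^ 2) ((ENNReal.continuous_const_mul hGfin).add
      ((ENNReal.continuous_const_mul hc).comp (ENNReal.continuous_pow 2)))
    (fun r s hrs => by dsimp only; gcongr) fun π hπ => ?_
  refine (ofReal_integral_sub_integral_le hπ hμ hν).trans
    ((lintegral_mono fun x : α × α => h x.1 x.2).trans ?_)
  rw [lintegral_add_left (by fun_prop), lintegral_const_mul' _ _ hc]
  refine add_le_add ?_ (mul_le_mul' le_rfl ?_)
  · have hGπ : ∫⁻ x, G x ^ (2 : ℝ) ∂ν = ∫⁻ x, G x.2 ^ (2 : ℝ) ∂π := by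
      rw [← hπ.2, lintegral_map (by fun_prop) measurable_snd]
    rw [hGπ]
    exact ENNReal.lintegral_mul_le_Lp_mul_Lq π Real.HolderConjugate.two_two
      (f := fun x => G x.2) (by fun_prop) (g := fun x => edist x.1 x.2) (by fun_prop)
  · rw [← ENNReal.rpow_natCast, ← ENNReal.rpow_mul]
    norm_num

end CouplingBounds

/-! ### Smooth and Lipschitz functions. -/

section Smooth

/-- The descent lemma. -/
theorem abs_sub_sub_inner_gradient_le {E : Type*} [NormedAddCommGroup E] [InnerProductSpace ℝ E]
    [CompleteSpace E] {f : E → ℝ} {a : ℝ≥0} (hf : Differentiable ℝ f)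
    (hg : LipschitzWith a (gradient f)) (z h : E) :
    |f (z + h) - f z - inner ℝ (gradient f z) h| ≤ a / 2 * ‖h‖ ^ 2 := by
  -- The first-order remainder along the segment vanishes at 0 and has derivative at most a t ‖h‖²
  -- in norm, so it stays below the primitive a/2 t² ‖h‖².
  have hder (t : ℝ) : HasDerivAt (fun t : ℝ => f (z + t • h) - f z - t * inner ℝ (gradient f z) h)
      (inner ℝ (gradient f (z + t • h)) h - inner ℝ (gradient f z) h) t := by
    have h1 : HasDerivAt (fun t : ℝ => z + t • h) h t := by
      simpa using ((hasDerivAt_id t).smul_const h).const_add z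
    have h2 := ((hf (z + t • h)).hasGradientAt.hasFDerivAt).comp_hasDerivAt t h1
    have h3 := (hasDerivAt_id t).mul_const (inner ℝ (gradient f z) h)
    simp only [id_eq, one_mul] at h3
    exact (h2.sub_const (f z)).sub h3
  have hB (t : ℝ) : HasDerivAt (fun t : ℝ => a / 2 * t ^ 2 * ‖h‖ ^ 2) (a * t * ‖h‖ ^ 2) t := by
    refine (((hasDerivAt_pow 2 t).const_mul ((a : ℝ) / 2)).mul_const (‖h‖ ^ 2)).congr_deriv ?_
    push_cast
    ring
  have := image_norm_le_of_norm_deriv_right_le_deriv_boundary (a := 0) (b := 1)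
    (fun t _ => (hder t).continuousAt.continuousWithinAt)
    (fun t _ => (hder t).hasDerivWithinAt) (B := fun t : ℝ => a / 2 * t ^ 2 * ‖h‖ ^ 2) (by simp) hB
    (fun t ht => by
      rw [← inner_sub_left]
      refine (norm_inner_le_norm _ _).trans ?_
      have h4 := hg.norm_sub_le (z + t • h) z
      rw [add_sub_cancel_left, norm_smul, Real.norm_of_nonneg ht.1] at h4
      calc ‖gradient f (z + t • h) - gradient f z‖ * ‖h‖ ≤ (a * (t * ‖h‖)) * ‖h‖ := by gcongr
        _ = a * t * ‖h‖ ^ 2 := by ring) (Set.right_mem_Icc.2 zero_le_one)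
  simpa using this

theorem abs_sub_le_of_lipschitzWith_gradient {E : Type*} [NormedAddCommGroup E]
    [InnerProductSpace ℝ E] [CompleteSpace E] {f : E → ℝ} {a : ℝ≥0} (hf : Differentiable ℝ f)
    (hg : LipschitzWith a (gradient f)) (x y : E) :
    |f x - f y| ≤ ‖gradient f y‖ * ‖x - y‖ + a / 2 * ‖x - y‖ ^ 2 := by
  have h1 := abs_sub_sub_inner_gradient_le hf hg y (x - y)
  rw [add_sub_cancel] at h1
  have h2 := abs_real_inner_le_norm (gradient f y) (x - y)
  have h3 := abs_add_le (f x - f y - inner ℝ (gradient f y) (x - y))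
    (inner ℝ (gradient f y) (x - y))
  rw [sub_add_cancel] at h3
  linarith

theorem ofReal_sub_le_of_lipschitzWith_gradient {E : Type*} [NormedAddCommGroup E]
    [InnerProductSpace ℝ E] [CompleteSpace E] {f : E → ℝ} {a : ℝ≥0} (hf : Differentiable ℝ f)
    (hg : LipschitzWith a (gradient f)) (x y : E) :
    ENNReal.ofReal (f x - f y) ≤
      ‖gradient f y‖ₑ * edist x y + (a : ℝ≥0∞) / 2 * edist x y ^ (2 : ℝ) := by
  refine (ENNReal.ofReal_le_ofReal ((le_abs_self _).trans
    (abs_sub_le_of_lipschitzWith_gradient hf hg x y))).trans_eq ?_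
  rw [ENNReal.ofReal_add (by positivity) (by positivity), ENNReal.ofReal_mul (by positivity),
    ENNReal.ofReal_mul (by positivity), ENNReal.ofReal_div_of_pos (by norm_num),
    ENNReal.ofReal_pow (by positivity), ofReal_norm, ofReal_norm, edist_eq_enorm_sub,
    ENNReal.ofReal_coe_nnreal, ENNReal.ofReal_ofNat, ENNReal.rpow_ofNat]

/-- The infimum of the Lipschitz constants is itself one: multiplication by the finite `edist x y`
commutes with the infimum over a nonempty set. -/
theorem edist_le_lipSeminorm_mul_edist {α : Type*} [PseudoMetricSpace α] {f : α → ℝ}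
    (hf : ∃ K : ℝ≥0, LipschitzWith K f) (x y : α) :
    edist (f x) (f y) ≤ lipSeminorm f * edist x y := by
  have : Nonempty {K : ℝ≥0 // LipschitzWith K f} := let ⟨K, hK⟩ := hf; ⟨⟨K, hK⟩⟩
  rw [lipSeminorm, iInf_subtype', ENNReal.iInf_mul (by simp [edist_ne_top])]
  exact le_iInf fun K => K.2 x y

end Smooth

/-! ### Excess risk: optimality, integrability and reduction to dimension `k`. -/

section Risk

theorem expect_eq_integral {α : Type*} [MeasurableSpace α] {μ : Measure α} {f : α → ℝ}
    (hf : Integrable f μ) : expect μ f = ((∫ x, f x ∂μ : ℝ) : EReal) := by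
  have h1 : ∫⁻ x, ENNReal.ofReal (f x) ∂μ ≠ ∞ := hf.lintegral_lt_top.ne
  have h2 : ∫⁻ x, ENNReal.ofReal (-f x) ∂μ ≠ ∞ := hf.neg.lintegral_lt_top.ne
  rw [expect, integral_eq_lintegral_pos_part_sub_lintegral_neg_part hf, EReal.coe_sub,
    EReal.coe_ennreal_toReal h1, EReal.coe_ennreal_toReal h2]

/-- Feasibility of `μ` and optimality of `lhat` reduce the excess risk to how much the expectation
of the single comparison loss `l` can increase from `μ` to another feasible measure. -/
theorem expect_sub_expect_le {α : Type*} [MeasurableSpace α] [PseudoEMetricSpace α] {p ε ρ : ℝ}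
    {G : Set (ProbabilityMeasure α)} {μ μt : ProbabilityMeasure α} (hμ : μ ∈ G)
    (hμt : robustWasserstein p ε μt μ ≤ ENNReal.ofReal ρ) {lhat l : α → ℝ}
    (hle : worstCaseRisk p ε ρ G μt lhat ≤ worstCaseRisk p ε ρ G μt l)
    (hint : ∀ ν ∈ G, Integrable l (ν : Measure α)) {B : ℝ≥0∞}
    (hB : ∀ ν ∈ G, robustWasserstein p ε μt ν ≤ ENNReal.ofReal ρ →
      ENNReal.ofReal (∫ x, l x ∂(ν : Measure α) - ∫ x, l x ∂(μ : Measure α)) ≤ B) :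
    expect (μ : Measure α) lhat - expect (μ : Measure α) l ≤ (B : EReal) := by
  rw [expect_eq_integral (hint μ hμ)]
  refine EReal.sub_le_of_le_add ?_
  calc expect (μ : Measure α) lhat ≤ worstCaseRisk p ε ρ G μt lhat :=
        le_iSup₂ (f := fun (ν : ProbabilityMeasure α)
          (_ : ν ∈ G ∧ robustWasserstein p ε μt ν ≤ ENNReal.ofReal ρ) =>
            expect (ν : Measure α) lhat) μ ⟨hμ, hμt⟩
    _ ≤ worstCaseRisk p ε ρ G μt l := hle
    _ ≤ _ := iSup₂_le fun ν hν => by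
        rw [expect_eq_integral (hint ν hν.1)]
        have h1 := hB ν hν.1 hν.2
        induction B with
        | top => simp
        | coe b =>
          rw [ENNReal.ofReal_le_iff_le_toReal ENNReal.coe_ne_top, ENNReal.coe_toReal] at h1
          rw [EReal.coe_nnreal_eq_coe_real, ← EReal.coe_add, EReal.coe_le_coe_iff]
          linarith

theorem exists_memLp_dist {α : Type*} [MeasurableSpace α] [PseudoMetricSpace α]
    [OpensMeasurableSpace α] {p : ℝ} (hp : 0 < p) {μ : ProbabilityMeasure α}
    (h : μ ∈ finiteMoment α p) :
    ∃ z₀, MemLp (fun z => dist z z₀) (ENNReal.ofReal p) (μ : Measure α) := by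
  obtain ⟨z₀, hz₀⟩ : ∃ z₀, ∫⁻ z, edist z z₀ ^ p ∂(μ : Measure α) < ∞ := by
    simpa [finiteMoment, iInf_lt_iff] using h
  refine ⟨z₀, Continuous.aestronglyMeasurable (by fun_prop), ?_⟩
  rw [eLpNorm_lt_top_iff_lintegral_rpow_enorm_lt_top (by simpa using hp) (by simp),
    ENNReal.toReal_ofReal hp.le]
  refine lt_of_le_of_lt (lintegral_mono fun z => ?_) hz₀
  rw [edist_dist, Real.enorm_of_nonneg dist_nonneg]

variable {d k : ℕ} {Z : Set (EucSp d)}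

theorem integrable_of_lipschitzWith {μ : ProbabilityMeasure Z} (hμ : μ ∈ finiteMoment Z 1)
    {f : EucSp d → ℝ} {K : ℝ≥0} (hf : LipschitzWith K f) :
    Integrable (fun z : Z => f z) (μ : Measure Z) := by
  obtain ⟨z₀, hz₀⟩ := exists_memLp_dist one_pos hμ
  rw [ENNReal.ofReal_one, memLp_one_iff_integrable] at hz₀
  refine ((integrable_const |f z₀|).add (hz₀.const_mul K)).mono'
    (hf.continuous.comp continuous_subtype_val).aestronglyMeasurable (.of_forall fun z => ?_)
  have h1 := hf.dist_le_mul z z₀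
  rw [Real.dist_eq] at h1
  have h2 := abs_add_le (f z₀) (f z - f z₀)
  rw [add_sub_cancel] at h2
  rw [Real.norm_eq_abs]
  exact h2.trans (by simpa [Subtype.dist_eq] using h1)

theorem memLp_gradient {μ : ProbabilityMeasure Z} (hμ : μ ∈ finiteMoment Z 2)
    {f : EucSp d → ℝ} {a : ℝ≥0} (hf : IsSmoothWith a f) :
    MemLp (fun z : Z => gradient f z) 2 (μ : Measure Z) := by
  obtain ⟨z₀, hz₀⟩ := exists_memLp_dist two_pos hμ
  rw [ENNReal.ofReal_ofNat] at hz₀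
  refine ((memLp_const ‖gradient f z₀‖).add (hz₀.const_mul (a : ℝ))).mono'
    (hf.2.continuous.comp continuous_subtype_val).aestronglyMeasurable (.of_forall fun z => ?_)
  have h1 := hf.2.dist_le_mul z z₀
  rw [dist_eq_norm] at h1
  have h2 := norm_add_le (gradient f z₀) (gradient f z - gradient f z₀)
  rw [add_sub_cancel] at h2
  exact h2.trans (by simpa [Subtype.dist_eq] using h1)

theorem integrable_of_isSmoothWith {μ : ProbabilityMeasure Z} (hμ : μ ∈ finiteMoment Z 2)
    {f : EucSp d → ℝ} {a : ℝ≥0} (hf : IsSmoothWith a f) :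
    Integrable (fun z : Z => f z) (μ : Measure Z) := by
  obtain ⟨z₀, hz₀⟩ := exists_memLp_dist two_pos hμ
  rw [ENNReal.ofReal_ofNat] at hz₀
  have hz₁ := hz₀.integrable one_le_two
  refine (((integrable_const |f z₀|).add (hz₁.const_mul ‖gradient f z₀‖)).add
    (hz₀.integrable_sq.const_mul (a / 2 : ℝ))).mono'
    (hf.1.continuous.comp continuous_subtype_val).aestronglyMeasurable (.of_forall fun z => ?_)
  have h1 := abs_sub_le_of_lipschitzWith_gradient (hf.1.differentiable one_ne_zero) hf.2 z z₀
  have h2 := abs_add_le (f z₀) (f z - f z₀)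
  rw [add_sub_cancel] at h2
  rw [Real.norm_eq_abs]
  simp only [Pi.add_apply, Subtype.dist_eq, dist_eq_norm]
  linarith

/-- Needed to identify the gradients at UᵀUz and at `z`, so that the projected gradient norm is the
one under `μ` itself. -/
theorem gradient_add_eq_of_forall_apply_add_eq {f : EucSp d → ℝ} {c : EucSp d}
    (h : ∀ z, f (z + c) = f z) (z : EucSp d) : gradient f (z + c) = gradient f z := by
  rw [gradient, gradient, ← fderiv_comp_add_right]
  simp only [h]

theorem wassersteinDist_projection_le_riskRadius {p ε ρ : ℝ} (hp : 1 ≤ p) (hε : 0 ≤ ε)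
    (hε' : 2 * ε < 1) {G : Set (ProbabilityMeasure Z)}
    {μ ν μt : ProbabilityMeasure Z} (hμ : μ ∈ G) (hν : ν ∈ G)
    (hμt : robustWasserstein p ε μt μ ≤ ENNReal.ofReal ρ)
    (hνt : robustWasserstein p ε μt ν ≤ ENNReal.ofReal ρ)
    {U : Matrix (Fin k) (Fin d) ℝ} (hU : U * Uᵀ = 1) :
    wassersteinDist p ((ν : Measure Z).map fun z : Z => Matrix.toEuclideanLin U (z : EucSp d))
      ((μ : Measure Z).map fun z : Z => Matrix.toEuclideanLin U (z : EucSp d)) ≤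
        riskRadius p ε ρ k G := by
  have hm : Measurable fun z : Z => Matrix.toEuclideanLin U (z : EucSp d) :=
    ((Matrix.toEuclideanLin U).continuous_of_finiteDimensional.comp
      continuous_subtype_val).measurable
  have key (η : ProbabilityMeasure Z) (hη : η ∈ G) : resilience p (2 * ε) (η.map hm.aemeasurable) ≤
      familyResilience p (2 * ε) (projectedFamily k G) :=
    le_iSup₂ (f := fun (κ : ProbabilityMeasure (EucSp k)) (_ : κ ∈ projectedFamily k G) =>
      resilience p (2 * ε) κ) (η.map hm.aemeasurable) ⟨U, hU, η, hη, rfl⟩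
  exact wassersteinDist_map_le_of_robustWasserstein_le hp hε hε' hμt hνt hm
    (fun x y => edist_toEuclideanLin_le hU x y) (key μ hμ) (key ν hν)

/-- Both integrals are integrals of f ∘ Uᵀ over the projected measures, and Uᵀ is an isometry, so
the Lipschitz constant is not increased. -/
theorem ofReal_integral_sub_integral_le_of_lipschitz {μ ν : ProbabilityMeasure Z}
    (hμ : μ ∈ finiteMoment Z 1) (hν : ν ∈ finiteMoment Z 1) {f : EucSp d → ℝ}
    (hf : ∃ K : ℝ≥0, LipschitzWith K f) {U : Matrix (Fin k) (Fin d) ℝ} (hU : U * Uᵀ = 1)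
    (hfU : ∀ z, f (Matrix.toEuclideanLin Uᵀ (Matrix.toEuclideanLin U z)) = f z) :
    ENNReal.ofReal (∫ z : Z, f z ∂(ν : Measure Z) - ∫ z : Z, f z ∂(μ : Measure Z)) ≤
      lipSeminorm f * wassersteinDist 1
        ((ν : Measure Z).map fun z : Z => Matrix.toEuclideanLin U (z : EucSp d))
        ((μ : Measure Z).map fun z : Z => Matrix.toEuclideanLin U (z : EucSp d)) := by
  have hm : Measurable fun z : Z => Matrix.toEuclideanLin U (z : EucSp d) :=
    ((Matrix.toEuclideanLin U).continuous_of_finiteDimensional.comp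
      continuous_subtype_val).measurable
  obtain ⟨K, hK⟩ := hf
  have hg : Continuous fun y : EucSp k => f (Matrix.toEuclideanLin Uᵀ y) :=
    hK.continuous.comp (Matrix.toEuclideanLin Uᵀ).continuous_of_finiteDimensional
  have hi (η : ProbabilityMeasure Z) (hη : η ∈ finiteMoment Z 1) :
      Integrable (fun y : EucSp k => f (Matrix.toEuclideanLin Uᵀ y))
        ((η : Measure Z).map fun z : Z => Matrix.toEuclideanLin U (z : EucSp d)) := by
    rw [integrable_map_measure hg.aestronglyMeasurable hm.aemeasurable]
    simpa only [Function.comp_def, hfU] using integrable_of_lipschitzWith hη hK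
  have hint (η : ProbabilityMeasure Z) : ∫ z : Z, f z ∂(η : Measure Z) =
      ∫ y, f (Matrix.toEuclideanLin Uᵀ y)
        ∂((η : Measure Z).map fun z : Z => Matrix.toEuclideanLin U (z : EucSp d)) := by
    rw [integral_map hm.aemeasurable hg.aestronglyMeasurable]
    simp only [hfU]
  have := Measure.isProbabilityMeasure_map (μ := (μ : Measure Z)) hm.aemeasurable
  have := Measure.isProbabilityMeasure_map (μ := (ν : Measure Z)) hm.aemeasurable
  rw [hint, hint]
  refine ofReal_integral_sub_integral_le_mul_wassersteinDist (hi ν hν) (hi μ hμ)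
    (ne_top_of_le_ne_top ENNReal.coe_ne_top (iInf₂_le K hK)) fun x y => ?_
  calc ENNReal.ofReal (f (Matrix.toEuclideanLin Uᵀ x) - f (Matrix.toEuclideanLin Uᵀ y))
      ≤ edist (f (Matrix.toEuclideanLin Uᵀ x)) (f (Matrix.toEuclideanLin Uᵀ y)) := by
        rw [edist_dist, Real.dist_eq]
        exact ENNReal.ofReal_le_ofReal (le_abs_self _)
    _ ≤ lipSeminorm f * edist x y := by
        rw [← edist_toEuclideanLin_transpose hU x y]
        exact edist_le_lipSeminorm_mul_edist ⟨K, hK⟩ _ _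

/-- The invariance `hfU` is assumed at every base point `w`, not only at `z`, because it has to be
differentiated. -/
theorem ofReal_integral_sub_integral_le_of_isSmoothWith {μ ν : ProbabilityMeasure Z}
    (hμ : μ ∈ finiteMoment Z 2) (hν : ν ∈ finiteMoment Z 2) {f : EucSp d → ℝ} {a : ℝ≥0}
    (hf : IsSmoothWith a f) {U : Matrix (Fin k) (Fin d) ℝ} (hU : U * Uᵀ = 1)
    (hfU : ∀ z w, f (w + (Matrix.toEuclideanLin Uᵀ (Matrix.toEuclideanLin U z) - z)) = f w) :
    ENNReal.ofReal (∫ z : Z, f z ∂(ν : Measure Z) - ∫ z : Z, f z ∂(μ : Measure Z)) ≤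
      sobolevSeminorm 2 ((μ : Measure Z).map Subtype.val) f * wassersteinDist 2
        ((ν : Measure Z).map fun z : Z => Matrix.toEuclideanLin U (z : EucSp d))
        ((μ : Measure Z).map fun z : Z => Matrix.toEuclideanLin U (z : EucSp d)) +
      (a : ℝ≥0∞) / 2 * wassersteinDist 2
        ((ν : Measure Z).map fun z : Z => Matrix.toEuclideanLin U (z : EucSp d))
        ((μ : Measure Z).map fun z : Z => Matrix.toEuclideanLin U (z : EucSp d)) ^ 2 := by
  have hm : Measurable fun z : Z => Matrix.toEuclideanLin U (z : EucSp d) :=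
    ((Matrix.toEuclideanLin U).continuous_of_finiteDimensional.comp
      continuous_subtype_val).measurable
  have hUt : Continuous fun y : EucSp k => Matrix.toEuclideanLin Uᵀ y :=
    (Matrix.toEuclideanLin Uᵀ).continuous_of_finiteDimensional
  have hfU' (z) : f (Matrix.toEuclideanLin Uᵀ (Matrix.toEuclideanLin U z)) = f z := by
    simpa using hfU z z
  have hgU (z) : gradient f (Matrix.toEuclideanLin Uᵀ (Matrix.toEuclideanLin U z)) =
      gradient f z := by
    simpa using gradient_add_eq_of_forall_apply_add_eq (hfU z) z
  have hg : Continuous fun y : EucSp k => f (Matrix.toEuclideanLin Uᵀ y) :=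
    hf.1.continuous.comp hUt
  have hG : Measurable fun y : EucSp k => ‖gradient f (Matrix.toEuclideanLin Uᵀ y)‖ₑ :=
    (hf.2.continuous.comp hUt).enorm.measurable
  have hi (η : ProbabilityMeasure Z) (hη : η ∈ finiteMoment Z 2) :
      Integrable (fun y : EucSp k => f (Matrix.toEuclideanLin Uᵀ y))
        ((η : Measure Z).map fun z : Z => Matrix.toEuclideanLin U (z : EucSp d)) := by
    rw [integrable_map_measure hg.aestronglyMeasurable hm.aemeasurable]
    simpa only [Function.comp_def, hfU'] using integrable_of_isSmoothWith hη hf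
  have hint (η : ProbabilityMeasure Z) : ∫ z : Z, f z ∂(η : Measure Z) =
      ∫ y, f (Matrix.toEuclideanLin Uᵀ y)
        ∂((η : Measure Z).map fun z : Z => Matrix.toEuclideanLin U (z : EucSp d)) := by
    rw [integral_map hm.aemeasurable hg.aestronglyMeasurable]
    simp only [hfU']
  have hS : sobolevSeminorm 2 ((μ : Measure Z).map Subtype.val) f =
      (∫⁻ z : Z, ‖gradient f z‖ₑ ^ (2 : ℝ) ∂(μ : Measure Z)) ^ (1 / (2 : ℝ)) := by
    rw [sobolevSeminorm, lintegral_map (hf.2.continuous.enorm.measurable.pow_const _)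
      measurable_subtype_coe]
  have hS' : sobolevSeminorm 2 ((μ : Measure Z).map Subtype.val) f =
      (∫⁻ y, ‖gradient f (Matrix.toEuclideanLin Uᵀ y)‖ₑ ^ (2 : ℝ)
        ∂((μ : Measure Z).map fun z : Z => Matrix.toEuclideanLin U (z : EucSp d))) ^
          (1 / (2 : ℝ)) := by
    rw [hS, lintegral_map (hG.pow_const _) hm]
    simp only [hgU]
  have hSfin : sobolevSeminorm 2 ((μ : Measure Z).map Subtype.val) f ≠ ∞ := by
    rw [hS]
    have := (memLp_gradient hμ hf).2
    rw [eLpNorm_lt_top_iff_lintegral_rpow_enorm_lt_top (by simp) (by simp),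
      ENNReal.toReal_ofNat] at this
    exact ENNReal.rpow_ne_top_of_nonneg (by norm_num) this.ne
  have := Measure.isProbabilityMeasure_map (μ := (μ : Measure Z)) hm.aemeasurable
  have := Measure.isProbabilityMeasure_map (μ := (ν : Measure Z)) hm.aemeasurable
  rw [hS'] at hSfin ⊢
  rw [hint, hint]
  refine ofReal_integral_sub_integral_le_of_sq (hi ν hν) (hi μ hμ) hG hSfin
    (ENNReal.div_ne_top ENNReal.coe_ne_top (by norm_num)) fun x y => ?_
  -- The isometry Uᵀ moves the estimate to `f` on the full space, so the gradient of f ∘ Uᵀ is never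
  -- computed.
  rw [← edist_toEuclideanLin_transpose hU x y]
  exact ofReal_sub_le_of_lipschitzWith_gradient (hf.1.differentiable one_ne_zero) hf.2 _ _

end Risk

/-! ### The excess risk bound. -/

theorem mainTheorem4
    -- the sample space
    {d : ℕ} (Z : Set (EucSp d)) (hZ : IsClosed Z)
    -- order of the Wasserstein distance, Wasserstein radius, contamination level
    (p ρ ε : ℝ) (hp : 1 ≤ p) (hρ : 0 ≤ ρ) (hε₀ : 0 ≤ ε) (hε₁ : ε ≤ 0.49)
    -- the loss functions
    (Loss : Set (Z → ℝ))
    (hlsc : ∀ l ∈ Loss, LowerSemicontinuous l)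
    (hgrowth : ∀ l ∈ Loss,
      BddAbove (Set.range fun z : Z => l z / (1 + ‖(z : EucSp d)‖ ^ p)))
    -- the class of clean distributions, the clean distribution, its corrupted version
    (G : Set (ProbabilityMeasure Z)) (hG : G ⊆ finiteMoment Z p)
    (μ : ProbabilityMeasure Z) (hμ : μ ∈ G)
    (μt : ProbabilityMeasure Z) (hμt : robustWasserstein p ε μt μ ≤ ENNReal.ofReal ρ)
    -- the decision, a minimizer of the outlier-robust WDRO problem
    (lhat : Z → ℝ) (hlhat : lhat ∈ Loss)
    (hlhat_min : ∀ l ∈ Loss, worstCaseRisk p ε ρ G μt lhat ≤ worstCaseRisk p ε ρ G μt l)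
    -- the optimal loss, which depends on `k`-dimensional affine features only
    (lstar : EucSp d → ℝ) (hlstar : (fun z : Z => lstar z) ∈ Loss)
    (hlstar_min : ∀ l ∈ Loss,
      expect (μ : Measure Z) (fun z : Z => lstar z) ≤ expect (μ : Measure Z) l)
    (k : ℕ) (hk : k ≤ d) (A : EucSp d →ᵃ[ℝ] EucSp k) (lbar : EucSp k → ℝ)
    (hfac : lstar = lbar ∘ A) :
    (p = 1 → (∃ K : ℝ≥0, LipschitzWith K lstar) →
      expect (μ : Measure Z) lhat - expect (μ : Measure Z) (fun z : Z => lstar z) ≤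
        ((lipSeminorm lstar * riskRadius p ε ρ k G : ℝ≥0∞) : EReal)) ∧
    (p = 2 → ∀ a : ℝ≥0, IsSmoothWith a lstar →
      expect (μ : Measure Z) lhat - expect (μ : Measure Z) (fun z : Z => lstar z) ≤
        ((sobolevSeminorm 2 ((μ : Measure Z).map Subtype.val) lstar * riskRadius p ε ρ k G +
          (a : ℝ≥0∞) / 2 * riskRadius p ε ρ k G ^ 2 : ℝ≥0∞) : EReal)) := by
  obtain ⟨U, hU, hAU⟩ := exists_mul_transpose_eq_one_and_apply_eq hk A.linear
  have hfU (z w : EucSp d) :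
      lstar (w + (Matrix.toEuclideanLin Uᵀ (Matrix.toEuclideanLin U z) - z)) = lstar w := by
    -- Translating the argument of an affine map changes its value by the linear part of the
    -- translation, and here the linear part of `A` vanishes on it.
    have h1 := A.map_vadd w (Matrix.toEuclideanLin Uᵀ (Matrix.toEuclideanLin U z) - z)
    rw [map_sub, hAU, sub_self, zero_vadd, vadd_eq_add, add_comm] at h1
    rw [hfac, Function.comp_apply, Function.comp_apply, h1]
  have hfU' (z : EucSp d) :
      lstar (Matrix.toEuclideanLin Uᵀ (Matrix.toEuclideanLin U z)) = lstar z := by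
    simpa using hfU z z
  have hε' : 2 * ε < 1 := by norm_num at hε₁; linarith
  refine ⟨?_, ?_⟩
  · rintro rfl hK
    refine expect_sub_expect_le hμ hμt (hlhat_min _ hlstar)
      (fun ν hν => integrable_of_lipschitzWith (hG hν) hK.choose_spec) fun ν hν hνt => ?_
    refine (ofReal_integral_sub_integral_le_of_lipschitz (hG hμ) (hG hν) hK hU hfU').trans ?_
    gcongr
    exact wassersteinDist_projection_le_riskRadius hp hε₀ hε' hμ hν hμt hνt hU
  · rintro rfl a ha
    refine expect_sub_expect_le hμ hμt (hlhat_min _ hlstar)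
      (fun ν hν => integrable_of_isSmoothWith (hG hν) ha) fun ν hν hνt => ?_
    refine (ofReal_integral_sub_integral_le_of_isSmoothWith (hG hμ) (hG hν) ha hU hfU).trans ?_
    have := wassersteinDist_projection_le_riskRadius hp hε₀ hε' hμ hν hμt hνt hU
    gcongr
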